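/- A \emph{product state} in $\mathbb{C}^m\otimes\mathbb{C}^n$ is a vector $a\otimes b$ with unit vectors $a\in\mathbb{C}^m$, $b\in\mathbb{C}^n$. An \emph{unextendible product basis} (UPB) in $\mathbb{C}^m\otimes\mathbb{C}^n$ is an orthonormal family of $s<mn$ product states such that no product state is orthogonal to all of its members; its \emph{missing states number} is $mn-s$. Theorem. Let $n\ge 7$ be an integer. Then for every integer $k$ with $4\le k\le 6n-14$, and also for $k=6n-12$ and for $k=6n-6$, there is a UPB in $\mathbb{C}^n\otimes\mathbb{C}^7$ with missing states number $k$. -/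

import Mathlib

open scoped TensorProduct

/-- The state space `ℂ^m ⊗ ℂ^n` of a bipartite quantum system, with its Hilbert space structure
`⟪a ⊗ b, c ⊗ d⟫ = ⟪a, c⟫ * ⟪b, d⟫`. -/
abbrev BipartiteSpace (m n : ℕ) : Type :=
  EuclideanSpace ℂ (Fin m) ⊗[ℂ] EuclideanSpace ℂ (Fin n)

/-- A product state: a tensor product of two pure states (unit vectors). -/
def IsProductState {m n : ℕ} (ψ : BipartiteSpace m n) : Prop :=
  ∃ (a : EuclideanSpace ℂ (Fin m)) (b : EuclideanSpace ℂ (Fin n)),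
    ‖a‖ = 1 ∧ ‖b‖ = 1 ∧ ψ = a ⊗ₜ[ℂ] b

/-- A `k`-member unextendible product basis (UPB) of `ℂ^m ⊗ ℂ^n`. -/
structure IsUPB {m n k : ℕ} (φ : Fin k → BipartiteSpace m n) : Prop where
  /-- the family is incomplete -/
  card_lt : k < m * n
  /-- every member is a product state -/
  isProductState : ∀ i, IsProductState (φ i)
  /-- the members are orthonormal -/
  orthonormal : Orthonormal ℂ φ
  /-- no product state is orthogonal to all members -/
  unextendible : ∀ ψ : BipartiteSpace m n, (∀ i, inner ℂ (φ i) ψ = 0) → ¬ IsProductState ψ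

/-- There is a UPB of `ℂ^m ⊗ ℂ^n` with missing states number `k`, that is, one whose number of
members `s` satisfies `m * n - s = k`. -/
def ExistsUPBWithMissing (m n k : ℕ) : Prop :=
  ∃ (s : ℕ) (φ : Fin s → BipartiteSpace m n), IsUPB φ ∧ s + k = m * n

/-! Call the dimension minus the number of members the deficiency. Families on orthogonal summands
of one factor combine and their deficiencies add (`HasDeficiency.add_left`). A product basis has
deficiency 0, so a deficiency once attained persists in larger dimensions.

Small deficiencies come from explicit integer vectors. Large ones come from a Fourier construction
(`hasDeficiency_of_fourier`): with `s = a + 6` and `ω` a primitive `s`-th root of unity, member `i`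
pairs the vectors `√(f j) ω^(p i j)` and `√(g j) ω^(q i j)`. By Vandermonde, any `a` left vectors
and any 7 right vectors are independent, so a nonzero product vector is orthogonal to at most `(a -
1) + 6 < s` members. Orthogonality of two members depends only on their index difference `d`. In
general positive `f` handles all `d` except ±1, ±2, ±3 modulo `s`, and positive `g` handles those
six. The result is deficiency `6 * (a - 1)` for every `a ≥ 3` (`hasDeficiency_seven_minimal`), and
direct sums supply the remaining values. -/

/-- A family of pairs of nonzero vectors whose tensor products are pairwise orthogonal and such that
no nonzero product vector is orthogonal to all of them. -/
structure IsUnextendibleFamily {m n : ℕ} {ι : Type} (x : ι → Fin m → ℂ) (y : ι → Fin n → ℂ) :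
    Prop where
  left_ne_zero : ∀ i, x i ≠ 0
  right_ne_zero : ∀ i, y i ≠ 0
  orthogonal : ∀ i j, i ≠ j → star (x i) ⬝ᵥ x j = 0 ∨ star (y i) ⬝ᵥ y j = 0
  unextendible : ∀ a b, (∀ i, star (x i) ⬝ᵥ a = 0 ∨ star (y i) ⬝ᵥ b = 0) → a = 0 ∨ b = 0

/-- There is an unextendible family in `ℂ^m ⊗ ℂ^n` with `k` members fewer than the dimension.
For `k = 0` complete families are allowed. -/
def HasDeficiency (m n k : ℕ) : Prop :=
  ∃ (ι : Type) (_ : Fintype ι) (x : ι → Fin m → ℂ) (y : ι → Fin n → ℂ),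
    IsUnextendibleFamily x y ∧ Fintype.card ι + k = m * n

theorem EuclideanSpace.inner_toLp_eq_star_dotProduct {m : ℕ} (x y : Fin m → ℂ) :
    inner ℂ (WithLp.toLp 2 x : EuclideanSpace ℂ (Fin m)) (WithLp.toLp 2 y) = star x ⬝ᵥ y := by
  rw [EuclideanSpace.inner_eq_star_dotProduct, dotProduct_comm]

theorem HasDeficiency.existsUPBWithMissing {m n k : ℕ} (h : HasDeficiency m n k) (hk : 0 < k) :
    ExistsUPBWithMissing m n k := by
  obtain ⟨ι, _, x, y, hf, hc⟩ := h
  let e := (Fintype.equivFin ι).symm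
  let u : Fin (Fintype.card ι) → EuclideanSpace ℂ (Fin m) := fun i => WithLp.toLp 2 (x (e i))
  let v : Fin (Fintype.card ι) → EuclideanSpace ℂ (Fin n) := fun i => WithLp.toLp 2 (y (e i))
  have hu : ∀ i, u i ≠ 0 := fun i h => hf.left_ne_zero (e i) (by simpa [u] using h)
  have hv : ∀ i, v i ≠ 0 := fun i h => hf.right_ne_zero (e i) (by simpa [v] using h)
  have normalized {E : Type} [NormedAddCommGroup E] [NormedSpace ℂ E] {w : E} (hw : w ≠ 0) :
      ‖((‖w‖⁻¹ : ℝ) : ℂ) • w‖ = 1 := by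
    rw [norm_smul, Complex.norm_real, norm_inv, norm_norm,
      inv_mul_cancel₀ (norm_ne_zero_iff.2 hw)]
  refine ⟨Fintype.card ι,
    fun i => (((‖u i‖⁻¹ : ℝ) : ℂ) • u i) ⊗ₜ[ℂ] (((‖v i‖⁻¹ : ℝ) : ℂ) • v i),
    ⟨by omega, fun i => ⟨_, _, normalized (hu i), normalized (hv i), rfl⟩, ⟨fun i => ?_, ?_⟩, ?_⟩,
    hc⟩
  · rw [TensorProduct.norm_tmul, normalized (hu i), normalized (hv i), one_mul]
  · intro i j hij
    have := hf.orthogonal (e i) (e j) (e.injective.ne hij)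
    rw [← EuclideanSpace.inner_toLp_eq_star_dotProduct,
      ← EuclideanSpace.inner_toLp_eq_star_dotProduct] at this
    simp only [TensorProduct.inner_tmul, inner_smul_left, inner_smul_right]
    rcases this with h | h
    · simp [u, h]
    · simp [v, h]
  · rintro ψ hψ ⟨a, b, ha, hb, rfl⟩
    have : a.ofLp = 0 ∨ b.ofLp = 0 := by
      refine hf.unextendible _ _ fun i => ?_
      rw [← EuclideanSpace.inner_toLp_eq_star_dotProduct,
        ← EuclideanSpace.inner_toLp_eq_star_dotProduct]
      obtain ⟨i, rfl⟩ := e.surjective i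
      have h := hψ i
      simp only [TensorProduct.inner_tmul, inner_smul_left, mul_eq_zero] at h
      have h1 := norm_ne_zero_iff.2 (hu i)
      have h2 := norm_ne_zero_iff.2 (hv i)
      simpa [h1, h2, hu i, hv i] using h
    rcases this with h | h
    · rw [(WithLp.ofLp_eq_zero 2).1 h] at ha; simp at ha
    · rw [(WithLp.ofLp_eq_zero 2).1 h] at hb; simp at hb

theorem HasDeficiency.swap {m n k : ℕ} (h : HasDeficiency m n k) : HasDeficiency n m k := by
  obtain ⟨ι, hι, x, y, hf, hc⟩ := h
  exact ⟨ι, hι, y, x, ⟨hf.right_ne_zero, hf.left_ne_zero, fun i j hij => (hf.orthogonal i j hij).symm,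
    fun a b h => (hf.unextendible b a fun i => (h i).symm).symm⟩, by rw [hc, mul_comm]⟩

theorem hasDeficiency_zero (m n : ℕ) : HasDeficiency m n 0 := by
  refine ⟨Fin m × Fin n, inferInstance, fun i => Pi.single i.1 1, fun i => Pi.single i.2 1,
    ⟨fun i => by simp, fun i => by simp, ?_, ?_⟩, by simp⟩
  · rintro ⟨i, j⟩ ⟨i', j'⟩ hij
    by_cases h : i = i'
    · right
      have : j ≠ j' := fun h' => hij (by rw [h, h'])
      simp [this]
    · left
      simp [h]
  · intro a b h
    by_contra! hab
    obtain ⟨i, hi⟩ := Function.ne_iff.1 hab.1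
    obtain ⟨j, hj⟩ := Function.ne_iff.1 hab.2
    have := h (i, j)
    simp at this
    simp_all

/-! ### Direct sums -/

theorem Fin.append_dotProduct_append {m₁ m₂ : ℕ} (a b : Fin m₁ → ℂ) (a' b' : Fin m₂ → ℂ) :
    Fin.append a a' ⬝ᵥ Fin.append b b' = a ⬝ᵥ b + a' ⬝ᵥ b' := by
  simp [dotProduct, Fin.sum_univ_add]

theorem Fin.star_append {m₁ m₂ : ℕ} (a : Fin m₁ → ℂ) (a' : Fin m₂ → ℂ) :
    star (Fin.append a a') = Fin.append (star a) (star a') := by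
  ext i
  refine Fin.addCases (fun i => ?_) (fun i => ?_) i <;> simp

/-- Unextendible families on orthogonal summands of the left factor combine. -/
theorem HasDeficiency.add_left {m₁ m₂ n k₁ k₂ : ℕ} (h₁ : HasDeficiency m₁ n k₁)
    (h₂ : HasDeficiency m₂ n k₂) : HasDeficiency (m₁ + m₂) n (k₁ + k₂) := by
  obtain ⟨ι₁, _, x₁, y₁, hf₁, hc₁⟩ := h₁
  obtain ⟨ι₂, _, x₂, y₂, hf₂, hc₂⟩ := h₂
  refine ⟨ι₁ ⊕ ι₂, inferInstance,
    Sum.elim (fun i => Fin.append (x₁ i) 0) (fun i => Fin.append 0 (x₂ i)), Sum.elim y₁ y₂,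
    ⟨?_, ?_, ?_, ?_⟩, by rw [Fintype.card_sum, add_mul, ← hc₁, ← hc₂]; omega⟩
  · rintro (i | i) h
    · exact hf₁.left_ne_zero i (funext fun j => by simpa using congrFun h (Fin.castAdd m₂ j))
    · exact hf₂.left_ne_zero i (funext fun j => by simpa using congrFun h (Fin.natAdd m₁ j))
  · rintro (i | i)
    · exact hf₁.right_ne_zero i
    · exact hf₂.right_ne_zero i
  · rintro (i | i) (j | j) hij
    · simpa [Fin.star_append, Fin.append_dotProduct_append] using
        hf₁.orthogonal i j (fun h => hij (by rw [h]))
    · left; simp [Fin.star_append, Fin.append_dotProduct_append]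
    · left; simp [Fin.star_append, Fin.append_dotProduct_append]
    · simpa [Fin.star_append, Fin.append_dotProduct_append] using
        hf₂.orthogonal i j (fun h => hij (by rw [h]))
  · intro a b h
    obtain ⟨a₁, a₂, rfl⟩ : ∃ a₁ a₂, a = Fin.append a₁ a₂ :=
      ⟨_, _, (Fin.append_castAdd_natAdd (f := a)).symm⟩
    by_cases hb : b = 0
    · exact Or.inr hb
    -- Both blocks share the right vector `b`; once it is nonzero, each block forces its own
    -- component of `a` to vanish.
    · have ha₁ := (hf₁.unextendible a₁ b fun i => by
        simpa [Fin.star_append, Fin.append_dotProduct_append] using h (Sum.inl i)).resolve_right hb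
      have ha₂ := (hf₂.unextendible a₂ b fun i => by
        simpa [Fin.star_append, Fin.append_dotProduct_append] using h (Sum.inr i)).resolve_right hb
      left
      rw [ha₁, ha₂]
      ext i
      refine Fin.addCases (fun i => ?_) (fun i => ?_) i <;> simp

theorem HasDeficiency.add_right {m n₁ n₂ k₁ k₂ : ℕ} (h₁ : HasDeficiency m n₁ k₁)
    (h₂ : HasDeficiency m n₂ k₂) : HasDeficiency m (n₁ + n₂) (k₁ + k₂) :=
  (h₁.swap.add_left h₂.swap).swap

theorem HasDeficiency.succ_left {m n k : ℕ} (h : HasDeficiency m n k) :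
    HasDeficiency (m + 1) n k :=
  h.add_left (hasDeficiency_zero 1 n)

/-! ### Small explicit families -/

theorem hasDeficiency_of_int {m n s k : ℕ} (X : Fin s → Fin m → ℤ) (Y : Fin s → Fin n → ℤ)
    (hX : ∀ i, X i ≠ 0) (hY : ∀ i, Y i ≠ 0)
    (orth : ∀ i j, i ≠ j → X i ⬝ᵥ X j = 0 ∨ Y i ⬝ᵥ Y j = 0)
    (unext : ∀ (a : Fin m → ℂ) (b : Fin n → ℂ),
      (∀ i, ∑ j, (X i j : ℂ) * a j = 0 ∨ ∑ j, (Y i j : ℂ) * b j = 0) → a = 0 ∨ b = 0)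
    (hk : s + k = m * n) : HasDeficiency m n k := by
  refine ⟨Fin s, inferInstance, fun i j => X i j, fun i j => Y i j, ⟨?_, ?_, ?_, ?_⟩, by simpa⟩
  · exact fun i h => hX i (funext fun j => by simpa using congrFun h j)
  · exact fun i h => hY i (funext fun j => by simpa using congrFun h j)
  · intro i j hij
    refine (orth i j hij).imp (fun h => ?_) (fun h => ?_)
    all_goals
      simp only [dotProduct, Pi.star_apply, star_intCast] at h ⊢
      exact_mod_cast h
  · intro a b h
    exact unext a b fun i => by simpa [dotProduct] using h i

/-- The Tiles construction: four dominoes surround the centre of the 3 × 3 grid, each carries a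
difference vector, and the all-ones vector blocks extension. -/
theorem hasDeficiency_three_three_four : HasDeficiency 3 3 4 := by
  refine hasDeficiency_of_int
    ![![0, 1, -1], ![0, 0, 1], ![-1, 1, 0], ![1, 0, 0], ![1, 1, 1]]
    ![![0, 0, 1], ![-1, 1, 0], ![1, 0, 0], ![0, -1, 1], ![1, 1, 1]]
    (by decide) (by decide) (by decide) (fun a b h => ?_) rfl
  simp [Fin.forall_fin_succ, Fin.sum_univ_succ] at h
  simp [funext_iff, Fin.forall_fin_succ]
  grind

/-- Tiles again: six dominoes, not all with adjacent cells, partition the 3 × 4 grid. The 4 × 4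
family of deficiency 7 uses eight dominoes in the same way. -/
theorem hasDeficiency_three_four_five : HasDeficiency 3 4 5 := by
  refine hasDeficiency_of_int
    ![![-1, 1, 0], ![1, 0, 0], ![-1, 0, 1], ![0, 1, 0], ![0, 1, -1], ![0, 0, 1], ![1, 1, 1]]
    ![![1, 0, 0, 0], ![0, 0, -1, 1], ![0, 1, 0, 0], ![0, 1, 0, -1], ![0, 0, 1, 0],
      ![-1, 0, 0, 1], ![1, 1, 1, 1]]
    (by decide) (by decide) (by decide) (fun a b h => ?_) rfl
  simp [Fin.forall_fin_succ, Fin.sum_univ_succ] at h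
  simp [funext_iff, Fin.forall_fin_succ]
  grind

theorem hasDeficiency_three_four_six : HasDeficiency 3 4 6 := by
  refine hasDeficiency_of_int
    ![![0, 0, 1], ![-1, 0, 0], ![0, 1, -1], ![1, 1, 1], ![-1, 2, -1], ![2, 1, 0]]
    ![![1, 1, 1, -1], ![0, 0, -1, 0], ![0, -1, 1, 0], ![1, -1, 0, 0], ![1, 0, 0, 1],
      ![0, 0, 0, 1]]
    (by decide) (by decide) (by decide) (fun a b h => ?_) rfl
  simp [Fin.forall_fin_succ, Fin.sum_univ_succ] at h
  simp [funext_iff, Fin.forall_fin_succ]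
  grind

theorem hasDeficiency_four_four_seven : HasDeficiency 4 4 7 := by
  refine hasDeficiency_of_int
    ![![-1, 0, 0, 1], ![0, 1, -1, 0], ![0, 0, 0, 1], ![0, 0, -1, 1], ![0, 1, 0, 0],
      ![0, 0, 1, 0], ![-1, 1, 0, 0], ![1, 0, 0, 0], ![1, 1, 1, 1]]
    ![![0, 0, 1, 0], ![1, 0, 0, 0], ![1, 0, 0, -1], ![0, 1, 0, 0], ![0, 1, -1, 0],
      ![0, 0, 1, -1], ![0, 0, 0, 1], ![1, -1, 0, 0], ![1, 1, 1, 1]]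
    (by decide) (by decide) (by decide) (fun a b h => ?_) rfl
  simp [Fin.forall_fin_succ, Fin.sum_univ_succ] at h
  simp [funext_iff, Fin.forall_fin_succ]
  grind

/-! ### Weighted Fourier families -/

theorem eq_zero_of_sum_mul_pow_eq_zero {ι : Type} {a : ℕ} {z : ι → ℂ} (hz : Function.Injective z)
    {S : Finset ι} (hS : a ≤ S.card) {c : Fin a → ℂ}
    (h : ∀ i ∈ S, ∑ j, c j * z i ^ (j : ℕ) = 0) : c = 0 := by
  obtain ⟨T, hTS, hT⟩ := Finset.exists_subset_card_eq hS
  let e := (Finset.equivFinOfCardEq hT).symm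
  exact Matrix.eq_zero_of_forall_index_sum_mul_pow_eq_zero (f := fun j => z (e j))
    (hz.comp (Subtype.val_injective.comp e.injective)) fun j => h _ (hTS (e j).2)

/-- Weighted Fourier vectors at an arithmetic progression of frequencies. -/
theorem star_weighted_pow_dotProduct {a : ℕ} {f : Fin a → ℝ} (hf : ∀ j, 0 < f j) {w z : ℂ} :
    star (fun j : Fin a => (√(f j) : ℂ) * w ^ (j : ℕ)) ⬝ᵥ (fun j => (√(f j) : ℂ) * z ^ (j : ℕ)) =
      ∑ j, (f j : ℂ) * (star w * z) ^ (j : ℕ) := by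
  refine Finset.sum_congr rfl fun j _ => ?_
  have : (√(f j) : ℂ) * √(f j) = f j := by
    exact_mod_cast Real.mul_self_sqrt (hf j).le
  simp only [Pi.star_apply, star_mul', star_pow, Complex.star_def, Complex.conj_ofReal, ← this]
  ring

/-- After conjugating the nodes and absorbing the weights into `c`, this counts roots of a nonzero
polynomial of degree below `a`. -/
theorem card_zeros_lt {ι : Type} [Fintype ι] [DecidableEq ι] {a : ℕ} {f : Fin a → ℝ}
    (hf : ∀ j, 0 < f j) {z : ι → ℂ} (hz : Function.Injective z) {c : Fin a → ℂ} (hc : c ≠ 0)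
    {S : Finset ι}
    (hS : ∀ i ∈ S, star (fun j : Fin a => (√(f j) : ℂ) * z i ^ (j : ℕ)) ⬝ᵥ c = 0) :
    S.card < a := by
  by_contra! h
  refine hc ?_
  have := eq_zero_of_sum_mul_pow_eq_zero (z := star ∘ z) (star_injective.comp hz) h
    (c := fun j => (√(f j) : ℂ) * c j) fun i hi => by
      rw [← hS i hi]
      refine Finset.sum_congr rfl fun j _ => ?_
      simp only [Function.comp, Pi.star_apply, star_mul', star_pow, Complex.star_def,
        Complex.conj_ofReal]
      ring
  funext j
  have h1 := congrFun this j
  have h2 : (√(f j) : ℂ) ≠ 0 := by exact_mod_cast (Real.sqrt_pos.2 (hf j)).ne'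
  simpa [h2] using h1

theorem star_pow_mul_pow_of_le {ω : ℂ} (hω : star ω * ω = 1) {i j : ℕ} (hij : i ≤ j) :
    star (ω ^ i) * ω ^ j = ω ^ (j - i) := by
  obtain ⟨d, rfl⟩ := Nat.exists_eq_add_of_le hij
  rw [pow_add, star_pow, ← mul_assoc, ← mul_pow, hω]
  simp

theorem star_dotProduct_eq_zero_symm {a : ℕ} (v w : Fin a → ℂ) (h : star v ⬝ᵥ w = 0) :
    star w ⬝ᵥ v = 0 := by
  rw [Matrix.star_dotProduct, h, star_zero]

/-- Two families of weighted Fourier vectors over `ℤ/s` with complementary orthogonality relations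
form a smallest possible unextendible family. -/
theorem hasDeficiency_of_fourier {a b s p q : ℕ} (hs : s + 1 = a + b) (ha : 0 < a) (hb : 0 < b)
    {ω : ℂ} (hω : IsPrimitiveRoot ω s) (hp : p.Coprime s) (hq : q.Coprime s)
    {f : Fin a → ℝ} {g : Fin b → ℝ} (hf : ∀ j, 0 < f j) (hg : ∀ j, 0 < g j)
    (h : ∀ d, 0 < d → d < s → ∑ j, (f j : ℂ) * ((ω ^ p) ^ d) ^ (j : ℕ) = 0 ∨
      ∑ j, (g j : ℂ) * ((ω ^ q) ^ d) ^ (j : ℕ) = 0) :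
    HasDeficiency a b ((a - 1) * (b - 1)) := by
  have hs0 : s ≠ 0 := by omega
  have unit {r : ℕ} : star (ω ^ r) * ω ^ r = 1 := by
    have := hω.norm'_eq_one hs0
    rw [Complex.star_def, Complex.conj_mul', norm_pow, this]
    simp
  have inj {r : ℕ} (hr : r.Coprime s) : Function.Injective fun i : Fin s => (ω ^ r) ^ (i : ℕ) :=
    fun i j hij => Fin.ext ((hω.pow_of_coprime r hr).pow_inj i.2 j.2 hij)
  have orth : ∀ i j : Fin s, i < j →
      star (fun t : Fin a => (√(f t) : ℂ) * ((ω ^ p) ^ (i : ℕ)) ^ (t : ℕ)) ⬝ᵥ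
        (fun t : Fin a => (√(f t) : ℂ) * ((ω ^ p) ^ (j : ℕ)) ^ (t : ℕ)) = 0 ∨
      star (fun t : Fin b => (√(g t) : ℂ) * ((ω ^ q) ^ (i : ℕ)) ^ (t : ℕ)) ⬝ᵥ
        (fun t : Fin b => (√(g t) : ℂ) * ((ω ^ q) ^ (j : ℕ)) ^ (t : ℕ)) = 0 := by
    intro i j hij
    have hij' : (i : ℕ) < j := hij
    rw [star_weighted_pow_dotProduct hf, star_weighted_pow_dotProduct hg,
      star_pow_mul_pow_of_le unit hij'.le, star_pow_mul_pow_of_le unit hij'.le]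
    exact h _ (by omega) (by omega)
  have ne_zero {c : ℕ} {r : Fin c → ℝ} (hc : 0 < c) (hr : ∀ j, 0 < r j) (z : ℂ) :
      (fun t : Fin c => (√(r t) : ℂ) * z ^ (t : ℕ)) ≠ 0 := fun h => by
    have := congrFun h ⟨0, hc⟩
    have h2 := (Real.sqrt_pos.2 (hr ⟨0, hc⟩)).ne'
    simp [h2] at this
  refine ⟨Fin s, inferInstance, fun i t => √(f t) * ((ω ^ p) ^ (i : ℕ)) ^ (t : ℕ),
    fun i t => √(g t) * ((ω ^ q) ^ (i : ℕ)) ^ (t : ℕ),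
    ⟨fun i => ne_zero ha hf _, fun i => ne_zero hb hg _, fun i j hij => ?_, fun A B hAB => ?_⟩, ?_⟩
  · rcases lt_or_gt_of_ne hij with hij | hij
    · exact orth i j hij
    · exact (orth j i hij).imp (star_dotProduct_eq_zero_symm _ _)
        (star_dotProduct_eq_zero_symm _ _)
  · classical
    by_contra! hne
    -- The members orthogonal to `A` number at most `a - 1` and the others, orthogonal to `B`, at
    -- most `b - 1`; together fewer than `s`.
    have h1 := card_zeros_lt hf (inj hp) hne.1 (S := Finset.univ.filter fun i : Fin s =>
      star (fun t : Fin a => (√(f t) : ℂ) * ((ω ^ p) ^ (i : ℕ)) ^ (t : ℕ)) ⬝ᵥ A = 0) (by simp)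
    have h2 := card_zeros_lt hg (inj hq) hne.2 (S := Finset.univ.filter fun i : Fin s =>
      ¬ star (fun t : Fin a => (√(f t) : ℂ) * ((ω ^ p) ^ (i : ℕ)) ^ (t : ℕ)) ⬝ᵥ A = 0)
      (fun i hi => (hAB i).resolve_left (by simpa using hi))
    have h3 := Finset.card_filter_add_card_filter_not (s := (Finset.univ : Finset (Fin s)))
      (fun i : Fin s =>
      star (fun t : Fin a => (√(f t) : ℂ) * ((ω ^ p) ^ (i : ℕ)) ^ (t : ℕ)) ⬝ᵥ A = 0)
    rw [Finset.card_univ, Fintype.card_fin] at h3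
    omega
  · obtain ⟨a, rfl⟩ := Nat.exists_eq_succ_of_ne_zero ha.ne'
    obtain ⟨b, rfl⟩ := Nat.exists_eq_succ_of_ne_zero hb.ne'
    simp only [Fintype.card_fin, Nat.succ_eq_add_one, Nat.add_sub_cancel]
    have : s = a + b + 1 := by omega
    rw [this]; ring

/-! ### Left weights: a trigonometric polynomial of small bandwidth -/

/-- The squared lengths for which the Fourier vectors at `a` consecutive frequencies modulo `a + 6`
have orthogonality relations given by a circulant band. -/
noncomputable def bandWeight (s j : ℕ) : ℝ :=
  ∏ m ∈ Finset.range 6, Real.sin (Real.pi * (j + (m + 1) : ℕ) / s)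

theorem bandWeight_pos {s j : ℕ} (h : j + 6 < s) : 0 < bandWeight s j := by
  refine Finset.prod_pos fun m hm => ?_
  have hm := Finset.mem_range.1 hm
  have hs : (0 : ℝ) < s := by exact_mod_cast (by omega : 0 < s)
  have h1 : (((j + (m + 1) : ℕ)) : ℝ) < s := by exact_mod_cast (by omega : j + (m + 1) < s)
  have h2 : (0 : ℝ) < ((j + (m + 1) : ℕ) : ℝ) := by positivity
  refine Real.sin_pos_of_pos_of_lt_pi (by positivity) ?_
  rw [div_lt_iff₀ hs]
  exact mul_lt_mul_of_pos_left h1 Real.pi_pos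

/-- Hence sums over the first `s - 6` frequencies extend to a full period. -/
theorem bandWeight_eq_zero {s j : ℕ} (h : s ≤ j + 6) (hj : j < s) : bandWeight s j = 0 := by
  refine Finset.prod_eq_zero (i := s - j - 1) (Finset.mem_range.2 (by omega)) ?_
  have hs : (s : ℝ) ≠ 0 := by exact_mod_cast (by omega : s ≠ 0)
  rw [show j + (s - j - 1 + 1) = s by omega, mul_div_assoc, div_self hs, mul_one, Real.sin_pi]

theorem Complex.sin_eq_exp_mul (t : ℂ) :
    Complex.sin t = Complex.I / 2 * (1 - Complex.exp (2 * t * Complex.I)) *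
      Complex.exp (-(t * Complex.I)) := by
  have : Complex.exp (2 * t * Complex.I) * Complex.exp (-(t * Complex.I)) =
      Complex.exp (t * Complex.I) := by
    rw [← Complex.exp_add]; congr 1; ring
  rw [Complex.sin, ← neg_mul]
  rw [← neg_mul] at this
  linear_combination (Complex.I / 2) * this

theorem exists_bandWeight_eq {s : ℕ} {ω : ℂ}
    (hω : ω = Complex.exp (2 * Real.pi * Complex.I / s)) :
    ∃ C : ℂ, ∀ j : ℕ, (bandWeight s j : ℂ) =
      C * ω⁻¹ ^ (3 * j) * ∏ m ∈ Finset.range 6, (1 - ω ^ (m + 1) * ω ^ j) := by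
  set ζ := Complex.exp (-(Real.pi / s * Complex.I)) with hζ
  have hζω : ζ ^ 2 = ω⁻¹ := by
    rw [hω, hζ, ← Complex.exp_nat_mul, ← Complex.exp_neg]; congr 1; push_cast; ring
  -- The exponent 21 is 1 + ⋯ + 6, from the six half-angle phases.
  refine ⟨(Complex.I / 2) ^ 6 * ζ ^ 21, fun j => ?_⟩
  have factor (m : ℕ) : (Real.sin (Real.pi * (j + (m + 1) : ℕ) / s) : ℂ) =
      Complex.I / 2 * (1 - ω ^ (m + 1) * ω ^ j) * ζ ^ (j + (m + 1)) := by
    have h1 : ω ^ (j + (m + 1)) =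
        Complex.exp (2 * (Real.pi * (j + (m + 1) : ℕ) / s : ℝ) * Complex.I) := by
      rw [hω, ← Complex.exp_nat_mul]
      congr 1; push_cast; ring
    have h2 : ζ ^ (j + (m + 1)) =
        Complex.exp (-((Real.pi * (j + (m + 1) : ℕ) / s : ℝ) * Complex.I)) := by
      rw [hζ, ← Complex.exp_nat_mul]
      congr 1; push_cast; ring
    rw [Complex.ofReal_sin, Complex.sin_eq_exp_mul, ← pow_add, add_comm (m + 1) j, h1, h2]
  rw [bandWeight, Complex.ofReal_prod, Finset.prod_congr rfl fun m _ => factor m, pow_mul,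
    ← hζω]
  simp only [Finset.prod_range_succ, Finset.prod_range_zero]
  ring

theorem sum_pow_mul_eq_zero {s : ℕ} {ω : ℂ} (hω : IsPrimitiveRoot ω s) {e : ℕ} (he : ¬ s ∣ e) :
    ∑ j ∈ Finset.range s, (ω ^ e) ^ j = 0 := by
  have h1 : ω ^ e ≠ 1 := fun h => he (hω.dvd_of_pow_eq_one e h)
  have h2 : (ω ^ e) ^ s = 1 := by rw [← pow_mul, mul_comm, pow_mul, hω.pow_eq_one, one_pow]
  rw [geom_sum_eq h1, h2, sub_self, zero_div]

theorem exists_prod_one_sub_mul_eq_sum (c : ℕ → ℂ) (N : ℕ) :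
    ∃ r : ℕ → ℂ, ∀ x : ℂ, ∏ m ∈ Finset.range N, (1 - c m * x) =
      ∑ k ∈ Finset.range (N + 1), r k * x ^ k := by
  let P : Polynomial ℂ := ∏ m ∈ Finset.range N, (1 - Polynomial.C (c m) * Polynomial.X)
  have hP : P.natDegree < N + 1 := by
    refine Nat.lt_succ_of_le ((Polynomial.natDegree_prod_le _ _).trans ?_)
    refine (Finset.sum_le_card_nsmul _ _ 1 fun m _ => ?_).trans (by simp)
    compute_degree
  refine ⟨P.coeff, fun x => ?_⟩
  rw [← Polynomial.eval_eq_sum_range' hP, Polynomial.eval_prod]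
  simp

/-- The weight has frequencies -3, …, 3 only, so the sum involves the characters `d - 3`, …, `d +
3`, all strictly between 0 and `s`. -/
theorem sum_bandWeight_eq_zero {s d : ℕ} {ω : ℂ}
    (hω : ω = Complex.exp (2 * Real.pi * Complex.I / s)) (hd : 4 ≤ d) (hds : d + 4 ≤ s) :
    ∑ j ∈ Finset.range s, (bandWeight s j : ℂ) * (ω ^ d) ^ j = 0 := by
  have hs : s ≠ 0 := by omega
  have hprim : IsPrimitiveRoot ω s := hω ▸ Complex.isPrimitiveRoot_exp s hs
  have hω0 : ω ≠ 0 := hprim.ne_zero hs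
  obtain ⟨C, hC⟩ := exists_bandWeight_eq hω
  obtain ⟨r, hr⟩ := exists_prod_one_sub_mul_eq_sum (fun m => ω ^ (m + 1)) 6
  have term (j : ℕ) : (bandWeight s j : ℂ) * (ω ^ d) ^ j =
      ∑ k ∈ Finset.range 7, C * r k * (ω ^ (d - 3 + k)) ^ j := by
    obtain ⟨e, rfl⟩ := Nat.exists_eq_add_of_le (show 3 ≤ d by omega)
    have h1 : ω⁻¹ ^ (3 * j) * ω ^ (3 * j) = 1 := by
      rw [← mul_pow, inv_mul_cancel₀ hω0, one_pow]
    rw [hC, hr, Finset.mul_sum, Finset.sum_mul]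
    refine Finset.sum_congr rfl fun k _ => ?_
    rw [show 3 + e - 3 + k = e + k by omega]
    simp only [← pow_mul, pow_add]
    rw [mul_comm j k]
    linear_combination (C * r k * ω ^ (k * j) * ω ^ (e * j)) * h1
  rw [Finset.sum_congr rfl fun j _ => term j, Finset.sum_comm]
  refine Finset.sum_eq_zero fun k hk => ?_
  have hk := Finset.mem_range.1 hk
  rw [← Finset.mul_sum, sum_pow_mul_eq_zero hprim, mul_zero]
  exact fun h => absurd (Nat.le_of_dvd (by omega) h) (by omega)

/-! ### Right weights: a palindromic polynomial with prescribed roots -/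

/-- The coefficients of `∏ i, (z ^ 2 - 2 * c i * z + 1)` for three numbers `c i`. -/
noncomputable def palindromicWeight (c₁ c₂ c₃ : ℝ) : Fin 7 → ℝ :=
  ![1, -2 * (c₁ + c₂ + c₃), 3 + 4 * (c₁ * c₂ + c₁ * c₃ + c₂ * c₃),
    -4 * (c₁ + c₂ + c₃) - 8 * (c₁ * c₂ * c₃), 3 + 4 * (c₁ * c₂ + c₁ * c₃ + c₂ * c₃),
    -2 * (c₁ + c₂ + c₃), 1]

theorem palindromicWeight_pos {c₁ c₂ c₃ : ℝ} (h₁ : c₁ + c₂ + c₃ < 0)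
    (h₂ : 0 < 3 + 4 * (c₁ * c₂ + c₁ * c₃ + c₂ * c₃))
    (h₃ : c₁ + c₂ + c₃ + 2 * (c₁ * c₂ * c₃) < 0) (j : Fin 7) :
    0 < palindromicWeight c₁ c₂ c₃ j := by
  fin_cases j <;> simp [palindromicWeight] <;> linarith

theorem sum_palindromicWeight_mul_pow (c₁ c₂ c₃ : ℝ) (z : ℂ) :
    ∑ j, (palindromicWeight c₁ c₂ c₃ j : ℂ) * z ^ (j : ℕ) =
      (z ^ 2 - 2 * c₁ * z + 1) * (z ^ 2 - 2 * c₂ * z + 1) * (z ^ 2 - 2 * c₃ * z + 1) := by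
  simp [palindromicWeight, Fin.sum_univ_succ]
  ring

theorem exp_quadratic (θ : ℝ) :
    Complex.exp (θ * Complex.I) ^ 2 - 2 * (Real.cos θ : ℝ) * Complex.exp (θ * Complex.I) + 1 = 0 := by
  have : Complex.exp (θ * Complex.I) * Complex.exp (-(θ * Complex.I)) = 1 := by
    rw [← Complex.exp_add]; simp
  rw [Complex.ofReal_cos, Complex.cos, neg_mul]
  linear_combination -this

/-- The differences `i` and `s - i` give conjugate roots of one real quadratic. -/
theorem pow_root_quadratic {s : ℕ} (hs : s ≠ 0) {ω : ℂ}
    (hω : ω = Complex.exp (2 * Real.pi * Complex.I / s)) {d i : ℕ} (q : ℕ)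
    (h : d = i ∨ d + i = s) :
    ((ω ^ q) ^ d) ^ 2 - 2 * (Real.cos (2 * Real.pi * q * i / s) : ℝ) * (ω ^ q) ^ d + 1 = 0 := by
  have hs' : (s : ℝ) ≠ 0 := by exact_mod_cast hs
  have h1 : (ω ^ q) ^ d = Complex.exp ((2 * Real.pi * q * d / s : ℝ) * Complex.I) := by
    rw [hω, ← Complex.exp_nat_mul, ← Complex.exp_nat_mul]
    congr 1; push_cast; ring
  have h2 : Real.cos (2 * Real.pi * q * i / s) = Real.cos (2 * Real.pi * q * d / s) := by
    rcases h with rfl | h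
    · rfl
    · have : (i : ℝ) = s - d := by rw [← h]; push_cast; ring
      rw [this, ← Real.cos_nat_mul_two_pi_sub _ q]
      congr 1; field_simp; ring
  rw [h1, h2, exp_quadratic]

theorem sum_palindromicWeight_eq_zero {s : ℕ} (hs : s ≠ 0) {ω : ℂ}
    (hω : ω = Complex.exp (2 * Real.pi * Complex.I / s)) {d i₁ i₂ i₃ : ℕ} (q : ℕ)
    (h : (d = i₁ ∨ d + i₁ = s) ∨ (d = i₂ ∨ d + i₂ = s) ∨ (d = i₃ ∨ d + i₃ = s)) :
    ∑ j, (palindromicWeight (Real.cos (2 * Real.pi * q * i₁ / s))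
      (Real.cos (2 * Real.pi * q * i₂ / s)) (Real.cos (2 * Real.pi * q * i₃ / s)) j : ℂ) *
        ((ω ^ q) ^ d) ^ (j : ℕ) = 0 := by
  rw [sum_palindromicWeight_mul_pow]
  rcases h with h | h | h <;> rw [pow_root_quadratic hs hω q h] <;> ring

theorem sum_fin_bandWeight_eq_zero {a d : ℕ} {ω : ℂ}
    (hω : ω = Complex.exp (2 * Real.pi * Complex.I / (a + 6 : ℕ))) (hd : 4 ≤ d)
    (hda : d + 4 ≤ a + 6) :
    ∑ j : Fin a, (bandWeight (a + 6) j : ℂ) * (ω ^ d) ^ (j : ℕ) = 0 := by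
  rw [Fin.sum_univ_eq_sum_range (fun j => (bandWeight (a + 6) j : ℂ) * (ω ^ d) ^ j),
    ← sum_bandWeight_eq_zero hω hd hda]
  refine Finset.sum_subset (by simp) fun j hj hj' => ?_
  rw [Finset.mem_range] at hj hj'
  rw [bandWeight_eq_zero (by omega) hj, Complex.ofReal_zero, zero_mul]

/-! ### Choice of the frequency step -/

/-- The circulant family of `a + 6` vectors in `ℂ^a ⊗ ℂ^7`, given a frequency step `q` for which
the weights of the second factor are positive. -/
theorem hasDeficiency_of_step {a q : ℕ} {c : ℝ} (ha : 0 < a) (hq : q.Coprime (a + 6))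
    (hc : c = Real.cos (2 * Real.pi * q / (a + 6 : ℕ)))
    (h₁ : (2 * c + 1) * (2 * c ^ 2 - 1) < 0)
    (h₂ : 0 < (2 * c + 1) * (4 * (2 * c ^ 2 - 1) ^ 2 + 2 * c - 1))
    (h₃ : (2 * c ^ 2 - 1) * (8 * c ^ 4 - 6 * c ^ 2 + 2 * c + 1) < 0) :
    HasDeficiency a 7 (6 * (a - 1)) := by
  set ω := Complex.exp (2 * Real.pi * Complex.I / (a + 6 : ℕ)) with hω
  have hc₁ : Real.cos (2 * Real.pi * q * (1 : ℕ) / (a + 6 : ℕ)) = c := by rw [hc]; simp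
  have hc₂ : Real.cos (2 * Real.pi * q * (2 : ℕ) / (a + 6 : ℕ)) = 2 * c ^ 2 - 1 := by
    rw [hc, ← Real.cos_two_mul]; congr 1; push_cast; ring
  have hc₃ : Real.cos (2 * Real.pi * q * (3 : ℕ) / (a + 6 : ℕ)) = 4 * c ^ 3 - 3 * c := by
    rw [hc, ← Real.cos_three_mul]; congr 1; push_cast; ring
  rw [mul_comm]
  refine hasDeficiency_of_fourier (s := a + 6) (p := 1) (q := q) (b := 7) rfl ha (by norm_num)
    (Complex.isPrimitiveRoot_exp _ (by omega)) (Nat.coprime_one_left _) hq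
    (f := fun j => bandWeight (a + 6) j) (g := palindromicWeight c (2 * c ^ 2 - 1) (4 * c ^ 3 - 3 * c))
    (fun j => bandWeight_pos (by omega)) (palindromicWeight_pos ?_ ?_ ?_) fun d hd hds => ?_
  -- For the cosines of an angle and its double and triple, the sign conditions factor as `h₁`,
  -- `h₂`, `h₃`.
  · linarith
  · linarith
  · linarith
  · by_cases h : 4 ≤ d ∧ d + 4 ≤ a + 6
    · left
      rw [pow_one]
      exact sum_fin_bandWeight_eq_zero hω h.1 h.2
    · right
      have h0 := sum_palindromicWeight_eq_zero (by omega) hω (d := d) (i₁ := 1) (i₂ := 2) (i₃ := 3)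
        q (by omega)
      rwa [hc₁, hc₂, hc₃] at h0

theorem step_conditions {c : ℝ} (hc : -1 / 4 ≤ c) (hc' : 2 * c ^ 2 < 1) :
    (2 * c + 1) * (2 * c ^ 2 - 1) < 0 ∧
      0 < (2 * c + 1) * (4 * (2 * c ^ 2 - 1) ^ 2 + 2 * c - 1) ∧
      (2 * c ^ 2 - 1) * (8 * c ^ 4 - 6 * c ^ 2 + 2 * c + 1) < 0 := by
  have h : 0 < 2 * c + 1 := by linarith
  refine ⟨mul_neg_of_pos_of_neg h (by linarith), mul_pos h ?_,
    mul_neg_of_neg_of_pos (by linarith) ?_⟩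
  · rcases lt_or_ge (1 / 2) c with hc2 | hc2
    · nlinarith [sq_nonneg (2 * c ^ 2 - 1)]
    · have h1 : c ^ 2 ≤ 1 / 4 := by nlinarith
      rcases le_or_gt c 0 with hc3 | hc3
      · have h2 : c ^ 2 ≤ 1 / 16 := by nlinarith
        nlinarith
      · nlinarith
  · rcases lt_or_ge (1 / 16) c with hc2 | hc2
    · nlinarith [sq_nonneg (c ^ 2 - 3 / 8)]
    · have h2 : c ^ 2 ≤ 1 / 16 := by nlinarith
      nlinarith [sq_nonneg (c ^ 2)]

/-- The ratio `q / s` lies above 1/8, so the doubled angle passes π/2, and is at most 15/52 = 1/4 +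
1/26, so the angle exceeds π/2 by at most π/13 < 1/4. -/
theorem cos_bounds {q s : ℕ} (h₁ : s < 8 * q) (h₂ : 52 * q ≤ 15 * s) :
    -1 / 4 ≤ Real.cos (2 * Real.pi * q / s) ∧ 2 * Real.cos (2 * Real.pi * q / s) ^ 2 < 1 := by
  have hs : (0 : ℝ) < s := by exact_mod_cast (by omega : 0 < s)
  have h1 : (s : ℝ) < 8 * q := by exact_mod_cast h₁
  have h2 : 52 * (q : ℝ) ≤ 15 * s := by exact_mod_cast h₂
  have hπ := Real.pi_pos
  have hπ' := Real.pi_lt_d2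
  have hx1 : (1 / 8 : ℝ) < q / s := by rw [lt_div_iff₀ hs]; linarith
  have hx2 : (q / s : ℝ) ≤ 15 / 52 := by rw [div_le_iff₀ hs]; linarith
  rw [mul_div_assoc]
  set x : ℝ := q / s
  constructor
  · rw [← neg_neg (Real.cos _), ← Real.sin_sub_pi_div_two]
    have : 2 * Real.pi * x - Real.pi / 2 ≤ 1 / 4 := by nlinarith
    rcases le_or_gt 0 (2 * Real.pi * x - Real.pi / 2) with h | h
    · linarith [Real.sin_le h]
    · have := Real.sin_nonpos_of_nonpos_of_neg_pi_le h.le (by nlinarith)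
      linarith
  · have := Real.cos_neg_of_pi_div_two_lt_of_lt (x := 2 * (2 * Real.pi * x)) (by nlinarith)
      (by nlinarith)
    rw [Real.cos_two_mul] at this
    linarith

/-- An integer near `s / 4` works, chosen odd when `s` is even. For `s = 10` and `s = 12` no coprime
integer lies in the range. -/
theorem exists_coprime_step {s : ℕ} (hs : 9 ≤ s) (h10 : s ≠ 10) (h12 : s ≠ 12) :
    ∃ q : ℕ, q.Coprime s ∧ s < 8 * q ∧ 52 * q ≤ 15 * s := by
  have key {q s : ℕ} (u v : ℤ) (h : u * q + v * s = 1) : q.Coprime s :=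
    Nat.isCoprime_iff_coprime.1 ⟨u, v, h⟩
  obtain ⟨m, hm | hm | hm | hm | hm | hm⟩ : ∃ m, s = 4 * m + 1 ∨ s + 1 = 4 * m ∨ s = 8 * m + 2 ∨
      s = 8 * m + 6 ∨ s = 8 * m ∨ s = 8 * m + 4 := by
    have : s % 8 < 8 := Nat.mod_lt _ (by norm_num)
    rcases (by omega : s % 4 = 1 ∨ s % 4 = 3 ∨ s % 4 % 2 = 0) with h | h | h
    · exact ⟨s / 4, by omega⟩
    · exact ⟨s / 4 + 1, by omega⟩
    · exact ⟨s / 8, by omega⟩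
  · exact ⟨m, key (-4) 1 (by rw [hm]; push_cast; ring), by omega, by omega⟩
  · refine ⟨m, key 4 (-1) ?_, by omega, by omega⟩
    have : (s : ℤ) + 1 = 4 * m := by exact_mod_cast hm
    linarith
  · refine ⟨2 * m + 1, key (1 - 4 * m) m ?_, by omega, by omega⟩
    rw [hm]; push_cast; ring
  · refine ⟨2 * m + 1, key (1 + 4 * m) (-m) ?_, by omega, by omega⟩
    rw [hm]; push_cast; ring
  · obtain ⟨m, rfl⟩ : ∃ l, m = l + 1 := ⟨m - 1, by omega⟩
    -- Here `s = 4 * q + 4`, and the Bézout identity comes from `q ^ 2 = 1 + 4 * (m ^ 2 + m)`. In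
    -- the last case `s = 4 * q + 8`, and odd squares are 1 modulo 8.
    refine ⟨2 * m + 1, key (2 * m + 1 + 4 * (m ^ 2 + m)) (-(m ^ 2 + m)) ?_, by omega, by omega⟩
    rw [hm]; push_cast; ring
  · obtain ⟨m, rfl⟩ : ∃ l, m = l + 1 := ⟨m - 1, by omega⟩
    obtain ⟨k, hk⟩ := Nat.even_mul_succ_self m
    refine ⟨2 * m + 1, key (2 * m + 1 + 4 * k) (-k) ?_, by omega, by omega⟩
    have : (m : ℤ) * (m + 1) = k + k := by exact_mod_cast hk
    rw [hm]; push_cast; linear_combination 4 * this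

/-- For `s = 10` no coprime step makes the band construction's right weights positive. The
differences are split instead as ±1, 5 on the left and ±2, ±3, ±4 on the right. -/
theorem hasDeficiency_four_seven_minimal : HasDeficiency 4 7 18 := by
  set ω := Complex.exp (2 * Real.pi * Complex.I / (10 : ℕ)) with hω
  have hprim : IsPrimitiveRoot ω 10 := Complex.isPrimitiveRoot_exp _ (by norm_num)
  set t := Real.cos (Real.pi / 5) with ht
  have ht2 : 4 * t ^ 2 - 2 * t - 1 = 0 := by
    rw [ht, Real.cos_pi_div_five]
    linear_combination (1 / 4) * Real.sq_sqrt (show (0 : ℝ) ≤ 5 by norm_num)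
  have ht0 : 0 < t := Real.cos_pos_of_mem_Ioo ⟨by linarith [Real.pi_pos], by linarith [Real.pi_pos]⟩
  have hc₂ : Real.cos (2 * Real.pi * (1 : ℕ) * (2 : ℕ) / (10 : ℕ)) = 2 * t ^ 2 - 1 := by
    rw [ht, ← Real.cos_two_mul]; congr 1; push_cast; ring
  have hc₃ : Real.cos (2 * Real.pi * (1 : ℕ) * (3 : ℕ) / (10 : ℕ)) = 1 - 2 * t ^ 2 := by
    rw [← neg_sub, ht, ← Real.cos_two_mul, ← Real.cos_pi_sub]; congr 1; push_cast; ring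
  have hc₃' : Real.cos (2 * Real.pi * (3 : ℕ) * (1 : ℕ) / (10 : ℕ)) = 1 - 2 * t ^ 2 := by
    rw [← hc₃]; congr 1; push_cast; ring
  have hc₄ : Real.cos (2 * Real.pi * (1 : ℕ) * (4 : ℕ) / (10 : ℕ)) = -t := by
    rw [ht, ← Real.cos_pi_sub]; congr 1; push_cast; ring
  have hmem : ∀ d, 0 < d → d < 10 → (d = 1 ∨ d + 1 = 10) ∨ d = 5 ∨
      ((d = 2 ∨ d + 2 = 10) ∨ (d = 3 ∨ d + 3 = 10) ∨ (d = 4 ∨ d + 4 = 10)) := by omega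
  refine hasDeficiency_of_fourier (s := 10) (p := 3) (q := 1) (a := 4) (b := 7) rfl (by norm_num)
    (by norm_num) hprim (by norm_num) (by norm_num) (f := ![1, 2 * t, 2 * t, 1])
    (g := palindromicWeight (2 * t ^ 2 - 1) (1 - 2 * t ^ 2) (-t))
    (fun j => by fin_cases j <;> simp [ht0]) (palindromicWeight_pos ?_ ?_ ?_) fun d hd hds => ?_
  · linarith
  · nlinarith
  · have h : 2 * t ^ 2 - 1 = t - 1 / 2 := by linarith
    have h' : (t - 1 / 2) ^ 2 = 1 / 2 - t / 2 := by linarith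
    rw [← neg_sub (2 * t ^ 2) 1, h,
      show t - 1 / 2 + -(t - 1 / 2) + -t + 2 * ((t - 1 / 2) * -(t - 1 / 2) * -t) =
        -t + 2 * t * (t - 1 / 2) ^ 2 by ring, h']
    nlinarith
  -- The weights 1, 2t, 2t, 1 are this product's coefficients, by the pentagon relation 4t² = 2t +
  -- 1.
  · have hf : ∑ j : Fin 4, ((![1, 2 * t, 2 * t, 1] : Fin 4 → ℝ) j : ℂ) *
        ((ω ^ 3) ^ d) ^ (j : ℕ) =
        (1 + (ω ^ 3) ^ d) * (((ω ^ 3) ^ d) ^ 2 - 2 * (1 - 2 * t ^ 2 : ℝ) * (ω ^ 3) ^ d + 1) := by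
      have : 4 * (t : ℂ) ^ 2 - 2 * t - 1 = 0 := by exact_mod_cast ht2
      simp [Fin.sum_univ_succ]
      linear_combination (-(1 + (ω ^ 3) ^ d) * (ω ^ 3) ^ d) * this
    rw [hf]
    rcases hmem d hd hds with h | rfl | h
    · left
      rw [← hc₃', pow_root_quadratic (by norm_num) hω 3 h, mul_zero]
    · left
      have h1 : (ω ^ 5) ^ 2 = 1 := by rw [← pow_mul]; exact hprim.pow_eq_one
      have h2 : ω ^ 5 ≠ 1 := hprim.pow_ne_one_of_pos_of_lt (by norm_num) (by norm_num)
      have h3 : ω ^ 5 = -1 := (eq_or_eq_neg_of_sq_eq_sq _ 1 (by rw [h1, one_pow])).resolve_left h2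
      rw [pow_right_comm, h3]
      norm_num
    · right
      rw [← hc₄, ← hc₂, ← hc₃]
      exact sum_palindromicWeight_eq_zero (by norm_num) hω 1 h

theorem hasDeficiency_seven_minimal {a : ℕ} (ha : 3 ≤ a) : HasDeficiency a 7 (6 * (a - 1)) := by
  by_cases h4 : a = 4
  · subst h4
    exact hasDeficiency_four_seven_minimal
  by_cases h6 : a = 6
  · subst h6
    -- The ratio 5/12 lies outside the range of `cos_bounds`, but the sign conditions hold directly.
    have hsq : Real.cos (2 * Real.pi * (5 : ℕ) / (6 + 6 : ℕ)) = -(√3 / 2) := by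
      rw [← Real.cos_pi_div_six, ← Real.cos_pi_sub]; congr 1; push_cast; ring
    have h3 : (√3) ^ 2 = 3 := Real.sq_sqrt (by norm_num)
    have h1 : 1 < √3 := by rw [Real.lt_sqrt] <;> norm_num
    have h4 : (√3) ^ 4 = 9 := by rw [show (√3) ^ 4 = ((√3) ^ 2) ^ 2 by ring, h3]; norm_num
    refine hasDeficiency_of_step (q := 5) (by norm_num) (by norm_num) hsq.symm ?_ ?_ ?_ <;>
      nlinarith
  · obtain ⟨q, hq, h1, h2⟩ := exists_coprime_step (s := a + 6) (by omega) (by omega) (by omega)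
    obtain ⟨hc, hc'⟩ := cos_bounds h1 h2
    obtain ⟨h₁, h₂, h₃⟩ := step_conditions hc hc'
    exact hasDeficiency_of_step (by omega) hq rfl h₁ h₂ h₃

/-! ### Assembling all deficiencies -/

theorem HasDeficiency.mono_left {m m' n k : ℕ} (h : HasDeficiency m n k) (hm : m ≤ m') :
    HasDeficiency m' n k := by
  induction hm with
  | refl => exact h
  | step _ ih => exact ih.succ_left

theorem HasDeficiency.mono_right {m n n' k : ℕ} (h : HasDeficiency m n k) (hn : n ≤ n') :
    HasDeficiency m n' k :=
  (h.swap.mono_left hn).swap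

theorem hasDeficiency_three_four {k : ℕ} (hk : k = 0 ∨ k = 4 ∨ k = 5 ∨ k = 6) :
    HasDeficiency 3 4 k := by
  rcases hk with rfl | rfl | rfl | rfl
  · exact hasDeficiency_zero 3 4
  · exact hasDeficiency_three_three_four.mono_right (by norm_num)
  · exact hasDeficiency_three_four_five
  · exact hasDeficiency_three_four_six

theorem hasDeficiency_three_seven {k : ℕ}
    (hk : k = 0 ∨ k = 4 ∨ k = 5 ∨ k = 6 ∨ k = 8 ∨ k = 9 ∨ k = 10) : HasDeficiency 3 7 k := by
  rcases (by omega : (k = 0 ∨ k = 4 ∨ k = 5 ∨ k = 6) ∨ 8 ≤ k) with h | h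
  · exact (hasDeficiency_three_four h).mono_right (by norm_num)
  · obtain ⟨l, rfl⟩ := Nat.exists_eq_add_of_le (show 4 ≤ k by omega)
    exact hasDeficiency_three_three_four.add_right (hasDeficiency_three_four (by omega))

theorem hasDeficiency_four_seven {k : ℕ} (hk : k = 0 ∨ 4 ≤ k ∧ k ≤ 13) : HasDeficiency 4 7 k := by
  have h {l : ℕ} (hl : l = 0 ∨ l = 4 ∨ l = 5 ∨ l = 6) : HasDeficiency 4 4 l :=
    (hasDeficiency_three_four hl).mono_left (by norm_num)
  obtain ⟨i, j, rfl, hi, hj⟩ : ∃ i j, k = i + j ∧ (i = 0 ∨ i = 4 ∨ i = 5 ∨ i = 6) ∧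
      ((j = 0 ∨ j = 4 ∨ j = 5 ∨ j = 6) ∨ j = 7) := by
    rcases (by omega : k = 0 ∨ k = 4 ∨ k = 5 ∨ k = 6 ∨ k = 7 ∨ k = 8 ∨ k = 9 ∨ k = 10 ∨ k = 11 ∨
      k = 12 ∨ k = 13) with rfl | rfl | rfl | rfl | rfl | rfl | rfl | rfl | rfl | rfl | rfl
    exacts [⟨0, 0, by omega⟩, ⟨0, 4, by omega⟩, ⟨0, 5, by omega⟩, ⟨0, 6, by omega⟩,
      ⟨0, 7, by omega⟩, ⟨4, 4, by omega⟩, ⟨4, 5, by omega⟩, ⟨4, 6, by omega⟩, ⟨4, 7, by omega⟩,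
      ⟨5, 7, by omega⟩, ⟨6, 7, by omega⟩]
  exact (hasDeficiency_three_four hi).swap.add_right
    (hj.elim h fun hj => hj ▸ hasDeficiency_four_four_seven)

theorem hasDeficiency_seven_seven {k : ℕ} (hk : 4 ≤ k ∧ k ≤ 28 ∨ k = 30 ∨ k = 36) :
    HasDeficiency 7 7 k := by
  have h₃ := hasDeficiency_seven_minimal (a := 3) (by norm_num)
  have h₄ := hasDeficiency_seven_minimal (a := 4) (by norm_num)
  have h₇ := hasDeficiency_seven_minimal (a := 7) (by norm_num)
  -- All but 36 come from 7 = 3 + 4. The value 25 is separate: 25 - 18 = 7 is not among the 3 × 7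
  -- values, so 12 + 13 is used.
  rcases (by omega : k ≤ 13 ∨ (14 ≤ k ∧ k ≤ 17) ∨ (18 ≤ k ∧ k ≤ 23) ∨ k = 25 ∨ k = 30 ∨ k = 36 ∨
    (k = 24 ∨ k = 26 ∨ k = 27 ∨ k = 28)) with h | h | h | rfl | rfl | rfl | h
  · exact (hasDeficiency_four_seven (by omega)).mono_left (by norm_num)
  · obtain ⟨l, rfl⟩ := Nat.exists_eq_add_of_le (show 4 ≤ k by omega)
    exact (hasDeficiency_three_seven (k := 4) (by omega)).add_left
      (hasDeficiency_four_seven (by omega))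
  · obtain ⟨l, rfl⟩ := Nat.exists_eq_add_of_le (show 10 ≤ k by omega)
    exact (hasDeficiency_three_seven (k := 10) (by omega)).add_left
      (hasDeficiency_four_seven (by omega))
  · exact h₃.add_left (hasDeficiency_four_seven (k := 13) (by omega))
  · exact h₃.add_left h₄
  · exact h₇
  · obtain ⟨l, rfl⟩ := Nat.exists_eq_add_of_le (show 18 ≤ k by omega)
    exact h₄.add_left (hasDeficiency_three_seven (by omega))

theorem hasDeficiency_seven {n : ℕ} (hn : 7 ≤ n) : ∀ {k : ℕ},
    (4 ≤ k ∧ k + 14 ≤ 6 * n ∨ k + 12 = 6 * n ∨ k + 6 = 6 * n) → HasDeficiency n 7 k := by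
  induction n, hn using Nat.le_induction with
  | base => exact fun hk => hasDeficiency_seven_seven (by omega)
  | succ n hn ih =>
    intro k hk
    by_cases hprev : 4 ≤ k ∧ k + 14 ≤ 6 * n ∨ k + 12 = 6 * n ∨ k + 6 = 6 * n
    · exact (ih hprev).succ_left
    obtain ⟨r, rfl⟩ := Nat.exists_eq_add_of_le' hn
    -- With `n = r + 7`, the new values are 6n, 6n - 11, and 6n - 18 + l for l = 5, 8, 9, 10. The
    -- value 6n - 11 would need l = 7, so it splits off four dimensions instead of three.
    rcases (by omega : k = 6 * (r + 8 - 1) ∨ k = 6 * (r + 4 - 1) + 13 ∨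
      6 * (r + 5 - 1) ≤ k ∧ k ≠ 6 * (r + 8 - 1) ∧ k ≠ 6 * (r + 4 - 1) + 13)
      with rfl | rfl | ⟨h, h₁, h₂⟩
    · exact hasDeficiency_seven_minimal (by omega)
    · exact (hasDeficiency_seven_minimal (a := r + 4) (by omega)).add_left
        (hasDeficiency_four_seven (by omega))
    · obtain ⟨l, rfl⟩ := Nat.exists_eq_add_of_le h
      exact (hasDeficiency_seven_minimal (a := r + 5) (by omega)).add_left
        (hasDeficiency_three_seven (by omega))

theorem theorem4 (n : ℕ) (hn : 7 ≤ n) (k : ℕ)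
    (hk : (4 ≤ k ∧ k + 14 ≤ 6 * n) ∨ k + 12 = 6 * n ∨ k + 6 = 6 * n) :
    ExistsUPBWithMissing n 7 k :=
  (hasDeficiency_seven hn hk).existsUPBWithMissing (by omega)
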